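/- All graphs are finite and simple. A graph is \emph{outerplanar} if it can be drawn in the plane without crossings so that all its vertices lie on the boundary of the outer (unbounded) face. The \emph{treedepth} $\mathrm{td}(G)$ of a graph $G$ is the minimum integer $d\ge 0$ for which there is a rooted forest with vertex set $V(G)$, of depth at most $d-1$ (roots have depth $0$), such that every edge of $G$ joins a vertex to one of its ancestors or descendants in the forest. \textbf{Theorem.} The class of outerplanar graphs is fractionally $\mathrm{td}$-fragile at rate $r(a)=2a(1+\lceil\log_2 a\rceil)$. That is, $r$ is non-negative and non-decreasing and, for every outerplanar graph $G$ and every positive integer $a$, there is a probability distribution on the subsets $X\subseteq V(G)$ with $\mathrm{td}(G-X)\le 2a(1+\lceil \log_2 a\rceil)$ such that each vertex of $G$ belongs to the random set $X$ with probability at most $1/a$. Moreover, if $G$ is an outerplanar graph that is chordal (every induced cycle of $G$ is a triangle), $v$ is a vertex of $G$, $j\ge 0$ is an integer, and $L_j$ is the set of vertices of $G$ at distance exactly $j$ from $v$, then every connected component of $G[L_j]$ is a path. -/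

import Mathlib

universe u

namespace SimpleGraph

/-! ### Plane drawings and outerplanar graphs -/

/-- A crossing-free drawing of a simple graph in the plane `ℂ = ℝ²`: vertices are distinct points,
an edge `uv` is drawn as a simple arc (the image of an injective continuous path) from the point
of `u` to the point of `v`, an arc contains no vertex points other than its ends, and two
different arcs meet only in the points of common end vertices. -/
structure PlaneDrawing {V : Type u} (G : SimpleGraph V) where
  point : V → ℂ
  arc : Sym2 V → Set ℂ
  point_injective : Function.Injective point
  isArc : ∀ u v : V, G.Adj u v →
    ∃ γ : _root_.Path (point u) (point v), Function.Injective γ ∧ Set.range γ = arc s(u, v)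
  point_mem_arc : ∀ e ∈ G.edgeSet, ∀ w : V, point w ∈ arc e → w ∈ e
  arc_inter_arc : ∀ e ∈ G.edgeSet, ∀ f ∈ G.edgeSet, e ≠ f →
    ∀ z ∈ arc e ∩ arc f, ∃ w : V, w ∈ e ∧ w ∈ f ∧ point w = z

namespace PlaneDrawing

variable {V : Type u} {G : SimpleGraph V}

/-- The set of all points of the plane used by the drawing. -/
def carrier (D : PlaneDrawing G) : Set ℂ :=
  Set.range D.point ∪ ⋃ e ∈ G.edgeSet, D.arc e

/-- The faces of a drawing are the connected components of its complement. -/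
def IsFace (D : PlaneDrawing G) (F : Set ℂ) : Prop :=
  ∃ z ∈ D.carrierᶜ, F = connectedComponentIn D.carrierᶜ z

/-- The outer face of a drawing is the unbounded one. -/
def IsOuterFace (D : PlaneDrawing G) (F : Set ℂ) : Prop :=
  D.IsFace F ∧ ¬ Bornology.IsBounded F

end PlaneDrawing

/-- A graph is outerplanar if it has a plane drawing in which all vertices lie on the boundary of
the outer face. -/
def IsOuterplanar {V : Type u} (G : SimpleGraph V) : Prop :=
  ∃ (D : PlaneDrawing G) (F : Set ℂ), D.IsOuterFace F ∧ ∀ v : V, D.point v ∈ frontier F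

/-! ### Treedepth -/

/-- `G` has a rooted forest of depth at most `d - 1` on its vertex set such that every edge of `G`
joins a vertex to one of its ancestors or descendants. The forest on a finite set is given by its
ancestor relation `anc x y` (`x` is `y` or an ancestor of `y`), a partial order in which any two
ancestors of a vertex are comparable; a vertex with `k` ancestors, itself included, has depth
`k - 1`. -/
def HasEliminationForest {V : Type u} (G : SimpleGraph V) (d : ℕ) : Prop :=
  ∃ anc : V → V → Prop,
    (∀ x, anc x x) ∧
    (∀ x y, anc x y → anc y x → x = y) ∧
    (∀ x y z, anc x y → anc y z → anc x z) ∧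
    (∀ x y z, anc x z → anc y z → anc x y ∨ anc y x) ∧
    (∀ x y, G.Adj x y → anc x y ∨ anc y x) ∧
    (∀ z, {x | anc x z}.Finite ∧ {x | anc x z}.ncard ≤ d)

/-- The treedepth of a (finite) graph. -/
noncomputable def treedepth {V : Type u} (G : SimpleGraph V) : ℕ :=
  sInf {d | G.HasEliminationForest d}

/-- For a finite graph the minimum in the definition of treedepth is attained. -/
theorem hasEliminationForest_treedepth {V : Type u} [Finite V] (G : SimpleGraph V) :
    G.HasEliminationForest G.treedepth := by
  apply Nat.sInf_mem (s := {d | G.HasEliminationForest d})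
  obtain ⟨n, ⟨e⟩⟩ := Finite.exists_equiv_fin V
  refine ⟨Nat.card V, fun x y => e x ≤ e y, fun x => le_refl _,
    fun x y h1 h2 => e.injective (le_antisymm h1 h2), fun x y z h1 h2 => le_trans h1 h2,
    fun x y z _ _ => le_total _ _, fun x y _ => le_total _ _, fun z => ⟨Set.toFinite _, ?_⟩⟩
  exact Set.ncard_le_card _

/-! ### Fractional fragility -/

/-- A graph `G` is fractionally `f`-fragile at rate `r`, for a graph parameter `f` and a
non-decreasing non-negative function `r`: for every positive integer `a` there is a probability
distribution on the sets `X` of vertices with `f (G - X) ≤ r a` such that each vertex belongs to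
the random set with probability at most `1 / a`. -/
def IsFractionallyFragile (f : ∀ W : Type u, SimpleGraph W → ℝ) (r : ℕ → ℝ)
    {V : Type u} (G : SimpleGraph V) : Prop :=
  Monotone r ∧ (∀ a, 0 ≤ r a) ∧
    ∀ a : ℕ, 1 ≤ a → ∃ P : PMF (Set V),
      (∀ X ∈ P.support, f _ (G.induce Xᶜ) ≤ r a) ∧
      ∀ v : V, P.toOuterMeasure {X | v ∈ X} ≤ 1 / (a : ENNReal)

/-- A class of finite graphs is fractionally `f`-fragile at rate `r` if each of its members is. -/
def IsFractionallyFragileClass (C : ∀ W : Type u, SimpleGraph W → Prop)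
    (f : ∀ W : Type u, SimpleGraph W → ℝ) (r : ℕ → ℝ) : Prop :=
  ∀ (V : Type u) [Finite V] (G : SimpleGraph V), C V G → G.IsFractionallyFragile f r

/-! ### Chordal graphs, breadth-first layers, unions of paths -/

/-- A graph is chordal if all its induced cycles are triangles. -/
def IsChordal {V : Type u} (G : SimpleGraph V) : Prop :=
  ∀ (v : V) (c : G.Walk v v), c.IsCycle → c.IsChordless → c.length = 3

/-- The vertices at distance exactly `j` from `v`. -/
def bfsLayer {V : Type u} (G : SimpleGraph V) (v : V) (j : ℕ) : Set V :=
  {w | G.edist v w = j}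

/-- Every connected component is a path. -/
def IsDisjointUnionOfPaths {V : Type u} (G : SimpleGraph V) : Prop :=
  ∀ c : G.ConnectedComponent, ∃ n : ℕ, Nonempty (c.toSimpleGraph ≃g pathGraph n)

end SimpleGraph

/-! ### Drawings of `K₃,₃` and `K₅` in the plane -/

/-! Topological input: an outerplanar graph has no `K₂,₃` and no `K₄` minor, since a new vertex
placed in the face touching all vertices would turn these into drawings of `K₃,₃` and `K₅`. Those
are excluded by winding numbers. For disjoint arcs `γ`, `δ` the difference `γ s - δ t` has a
continuous logarithm, whose total change around the parameter square is zero. This gives one integer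
relation per pair of disjoint edges (`exists_winding_relation`), and the relations for all pairs
contradict each other modulo 4.

Combinatorial input: take breadth-first layers and join two vertices of a layer also when they are
attached to a common component below it. Contracting everything above the layer, and suitable pieces
below it, would turn a vertex of degree three in this torso into a `K₂,₃` minor and a cycle into a
`K₄` minor. So every torso is a disjoint union of paths (`isAcyclic_layerTorso`,
`layerTorso_neighbors`). A distance layer induces a subgraph of its torso, which settles the
statement on layers.

Fragility: put `m = 2 * a` and delete, for a random shift, every `m`-th layer and every `m`-th
vertex along the torso paths; a vertex is hit by at most two of the `m` shifts. The remaining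
vertices are ranked first by layer within the block of layers and then, as in a balanced elimination
of a path, by the power of 2 dividing the position. A walk staying in or below a layer is shadowed
by a torso walk, so vertices of equal rank are separated by smaller ranks
(`eq_of_joinedOn_sparseRank`). There are `m * q` ranks, where `m ≤ 2 ^ q`. -/

theorem exists_continuous_log {A : Type*} [TopologicalSpace A] [SimplyConnectedSpace A]
    [LocallyPathConnectedSpace A] (f : C(A, ℂ)) (hf : ∀ a, f a ≠ 0) :
    ∃ g : C(A, ℂ), ∀ a, Complex.exp (g a) = f a := by
  obtain ⟨a₀⟩ : Nonempty A := inferInstance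
  obtain ⟨g, ⟨-, hg⟩, -⟩ := Complex.isCoveringMapOn_exp.existsUnique_continuousMap_lifts f (a₀ := a₀)
    (e₀ := Complex.log (f a₀)) (Complex.exp_log (hf a₀)) (fun a => hf a)
  exact ⟨g, fun a => congrFun hg a⟩

/-- `D` is the change along `γ` over the unit interval of a continuous logarithm of `γ - v`. -/
def IsLogChange (γ : ℝ → ℂ) (v D : ℂ) : Prop :=
  ∃ g : ℝ → ℂ, Continuous g ∧ (∀ t, Complex.exp (g t) = γ t - v) ∧ g 1 - g 0 = D

theorem IsLogChange.unique {γ : ℝ → ℂ} {v D D' : ℂ} (h : IsLogChange γ v D)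
    (h' : IsLogChange γ v D') : D = D' := by
  obtain ⟨g, hg, hgγ, rfl⟩ := h
  obtain ⟨g', hg', hgγ', rfl⟩ := h'
  have key : g = fun t => g' t + (g 0 - g' 0) := by
    refine Complex.isCoveringMap_exp.eq_of_comp_eq hg (by fun_prop) ?_ 0 (by simp)
    funext t
    apply Subtype.ext
    have h0 : Complex.exp (g 0 - g' 0) = 1 := by
      rw [Complex.exp_sub, hgγ, ← hgγ', div_self (Complex.exp_ne_zero _)]
    simp only [Function.comp_apply, Complex.exp_add, h0, hgγ, hgγ', mul_one]
  have := congrFun key 1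
  rw [this]; ring

/-- The four sides of the unit square on which a logarithm of `γ s - δ t` is defined. -/
theorem exists_isLogChange_of_disjoint {a b c d : ℂ} (γ : Path a b) (δ : Path c d)
    (h : Disjoint (Set.range γ) (Set.range δ)) :
    ∃ D₁ D₂ D₃ D₄ : ℂ, IsLogChange γ.extend c D₁ ∧ IsLogChange δ.extend b D₂ ∧
      IsLogChange γ.extend d D₃ ∧ IsLogChange δ.extend a D₄ ∧ D₁ + D₂ = D₃ + D₄ := by
  obtain ⟨g, hg⟩ := exists_continuous_log (A := ℝ × ℝ)
    ⟨fun x => γ.extend x.1 - δ.extend x.2, by fun_prop⟩ (by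
      intro x hx
      have hx' : γ.extend x.1 = δ.extend x.2 := sub_eq_zero.1 hx
      rw [← Path.extend_range, ← Path.extend_range] at h
      exact h.ne_of_mem ⟨x.1, rfl⟩ ⟨x.2, rfl⟩ hx')
  simp only [ContinuousMap.coe_mk] at hg
  refine ⟨_, _, _, _, ⟨fun s => g (s, 0), by fun_prop, fun s => ?_, rfl⟩,
    -- Adding `πi` turns a logarithm of `b - δ t` into one of `δ t - b` without affecting its
    -- change.
    ⟨fun t => g (1, t) + Real.pi * Complex.I, by fun_prop, fun t => ?_, rfl⟩,
    ⟨fun s => g (s, 1), by fun_prop, fun s => ?_, rfl⟩,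
    ⟨fun t => g (0, t) + Real.pi * Complex.I, by fun_prop, fun t => ?_, rfl⟩, by ring⟩
  · simp [hg]
  · simp [hg, Complex.exp_add]
  · simp [hg]
  · simp [hg, Complex.exp_add]

open Classical in
/-- The crossing parity relations of a plane drawing: `k` is a numbering of the vertices and `n v e`
counts how often the edge `e` winds around the vertex `v`. -/
theorem exists_winding_relation {ι ε : Type*} (p : ι → ℂ) (k : ι → ℕ) (hk : Function.Injective k)
    (src tgt : ε → ι) (S : ε → Set ℂ) (hS : ∀ e, JoinedIn (S e) (p (src e)) (p (tgt e))) :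
    ∃ n : ι → ε → ℤ, ∀ e f, Disjoint (S e) (S f) →
      2 * (n (src f) e + n (tgt e) f - n (tgt f) e - n (src e) f)
        + (if k (tgt e) < k (src f) then -1 else 1) - (if k (src e) < k (src f) then -1 else 1)
        + (if k (tgt f) < k (tgt e) then -1 else 1)
        + (if k (src e) < k (tgt f) then -1 else 1) = 0 := by
  -- Logarithms of `p u - p v` are fixed so that swapping `u` and `v` changes them by exactly `±πi`,
  -- with the sign read off from `k`.
  let L : ι → ι → ℂ := fun u v =>
    if k u < k v then Complex.log (p u - p v) else Complex.log (p v - p u) + Real.pi * Complex.I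
  have hL : ∀ u v, p u ≠ p v → Complex.exp (L u v) = p u - p v := by
    intro u v h
    by_cases huv : k u < k v
    · simp only [L, if_pos huv]
      exact Complex.exp_log (sub_ne_zero.2 h)
    · simp only [L, if_neg huv, Complex.exp_add, Complex.exp_pi_mul_I]
      rw [Complex.exp_log (sub_ne_zero.2 h.symm)]; ring
  have hanti : ∀ u v, p u ≠ p v →
      L u v - L v u = Real.pi * Complex.I * ((if k u < k v then -1 else 1 : ℤ) : ℂ) := by
    intro u v h
    have hne : k u ≠ k v := fun e => h (by rw [hk e])
    rcases lt_or_gt_of_ne hne with h1 | h1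
    · simp only [L, if_pos h1, if_neg (not_lt_of_gt h1)]; push_cast; ring
    · simp only [L, if_pos h1, if_neg (not_lt_of_gt h1)]; push_cast; ring
  let γ : ∀ e, Path (p (src e)) (p (tgt e)) := fun e => (hS e).somePath
  have hγ : ∀ e, Set.range (γ e) ⊆ S e := by
    rintro e _ ⟨t, rfl⟩
    exact (hS e).somePath_mem t
  -- The true change along `e` and the difference of the fixed logarithms have the same exponential.
  -- Their discrepancy, in units of `2πi`, is the winding number.
  have hn : ∀ v e, ∃ n : ℤ, ∀ D, IsLogChange (γ e).extend (p v) D → p (src e) ≠ p v →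
      p (tgt e) ≠ p v → D = L (tgt e) v - L (src e) v + n * (2 * Real.pi * Complex.I) := by
    intro v e
    by_cases hv : ∃ D, IsLogChange (γ e).extend (p v) D ∧ p (src e) ≠ p v ∧ p (tgt e) ≠ p v
    · obtain ⟨D, hD, h1, h2⟩ := hv
      have : Complex.exp D = Complex.exp (L (tgt e) v - L (src e) v) := by
        obtain ⟨g, -, hg, rfl⟩ := hD
        rw [Complex.exp_sub, Complex.exp_sub, hg, hg, hL _ _ h1, hL _ _ h2]
        simp
      obtain ⟨n, hn⟩ := Complex.exp_eq_exp_iff_exists_int.1 this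
      exact ⟨n, fun D' hD' _ _ => by rw [hD'.unique hD, hn]⟩
    · exact ⟨0, fun D h0 h1 h2 => (hv ⟨D, h0, h1, h2⟩).elim⟩
  choose n hn using hn
  refine ⟨n, fun e f hef => ?_⟩
  obtain ⟨D₁, D₂, D₃, D₄, h₁, h₂, h₃, h₄, hD⟩ :=
    exists_isLogChange_of_disjoint (γ e) (γ f) (hef.mono (hγ e) (hγ f))
  have hse := (hS e).source_mem
  have hte := (hS e).target_mem
  have hsf := (hS f).source_mem
  have htf := (hS f).target_mem
  have hac : p (src e) ≠ p (src f) := hef.ne_of_mem hse hsf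
  have had : p (src e) ≠ p (tgt f) := hef.ne_of_mem hse htf
  have hbc : p (tgt e) ≠ p (src f) := hef.ne_of_mem hte hsf
  have hbd : p (tgt e) ≠ p (tgt f) := hef.ne_of_mem hte htf
  have e₁ := hn _ _ _ h₁ hac hbc
  have e₂ := hn _ _ _ h₂ hbc.symm hbd.symm
  have e₃ := hn _ _ _ h₃ had hbd
  have e₄ := hn _ _ _ h₄ hac.symm had.symm
  have m₁ := hanti _ _ hbc
  have m₂ := hanti _ _ hac
  have m₃ := hanti _ _ hbd.symm
  have m₄ := hanti _ _ had
  have hpi : (Real.pi : ℂ) * Complex.I ≠ 0 :=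
    mul_ne_zero (by exact_mod_cast Real.pi_ne_zero) Complex.I_ne_zero
  apply Int.cast_injective (α := ℂ)
  apply mul_left_cancel₀ hpi
  rw [Int.cast_add, Int.cast_add, Int.cast_sub, Int.cast_add]
  push_cast at m₁ m₂ m₃ m₄ ⊢
  linear_combination hD - e₁ - e₂ + e₃ + e₄ - m₁ + m₂ - m₃ - m₄

/-- Over the 18 pairs of disjoint edges each winding number occurs in exactly two relations, with
coefficient `±2`, so these terms add up to 0 modulo 4. The signs add up to 2 for each of the 9 pairs
with `i < k` and `j < l` and to 0 otherwise, hence to 2 modulo 4. -/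
theorem not_exists_drawing_completeBipartite_three (x y : Fin 3 → ℂ) (S : Fin 3 → Fin 3 → Set ℂ)
    (hS : ∀ i j, JoinedIn (S i j) (x i) (y j))
    (hd : ∀ i j k l, i ≠ k → j ≠ l → Disjoint (S i j) (S k l)) : False := by
  obtain ⟨n, hn⟩ := exists_winding_relation (ι := Fin 3 ⊕ Fin 3) (ε := Fin 3 × Fin 3)
    (Sum.elim x y) (Sum.elim (fun i => i) (fun j => 3 + j))
    (by decide) (fun e => Sum.inl e.1) (fun e => Sum.inr e.2) (fun e => S e.1 e.2)
    (fun e => hS e.1 e.2)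
  have h : ∀ i k : Fin 3, i < k → ∀ j l : Fin 3, j ≠ l → _ :=
    fun i k hik j l hjl => hn (i, j) (k, l) (hd i j k l hik.ne hjl)
  have h01 := h 0 1 (by decide)
  have h02 := h 0 2 (by decide)
  have h12 := h 1 2 (by decide)
  have a1 := h01 0 1 (by decide)
  have a2 := h01 0 2 (by decide)
  have a3 := h01 1 2 (by decide)
  have a4 := h01 1 0 (by decide)
  have a5 := h01 2 0 (by decide)
  have a6 := h01 2 1 (by decide)
  have b1 := h02 0 1 (by decide)
  have b2 := h02 0 2 (by decide)
  have b3 := h02 1 2 (by decide)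
  have b4 := h02 1 0 (by decide)
  have b5 := h02 2 0 (by decide)
  have b6 := h02 2 1 (by decide)
  have c1 := h12 0 1 (by decide)
  have c2 := h12 0 2 (by decide)
  have c3 := h12 1 2 (by decide)
  have c4 := h12 1 0 (by decide)
  have c5 := h12 2 0 (by decide)
  have c6 := h12 2 1 (by decide)
  clear h h01 h02 h12 hn
  norm_num at a1 a2 a3 a4 a5 a6 b1 b2 b3 b4 b5 b6 c1 c2 c3 c4 c5 c6
  omega

/-- The same count over 15 pairs: the signs contribute 2 exactly when the ends interleave, once for
each of the five quadruples of vertices, and 10 is not divisible by 4. -/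
theorem not_exists_drawing_complete_five (p : Fin 5 → ℂ) (S : Fin 5 → Fin 5 → Set ℂ)
    (hS : ∀ i j, i < j → JoinedIn (S i j) (p i) (p j))
    (hd : ∀ i j k l, i < j → k < l → i ≠ k → i ≠ l → j ≠ k → j ≠ l → Disjoint (S i j) (S k l)) :
    False := by
  obtain ⟨n, hn⟩ := exists_winding_relation (ι := Fin 5) (ε := Fin 5 × Fin 5) p (fun i => i)
    Fin.val_injective (fun e => e.1) (fun e => e.2)
    -- Pairs that are not increasing get the whole plane as a dummy; no relation is ever taken for
    -- them.
    (fun e => if e.1 < e.2 then S e.1 e.2 else Set.univ)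
    (by
      rintro ⟨i, j⟩
      by_cases h : i < j
      · simpa [h] using hS i j h
      · simpa [h] using PathConnectedSpace.joined (p i) (p j))
  have h : ∀ i j k l : Fin 5, i < j → k < l → i < k → j ≠ k → j ≠ l → _ :=
    fun i j k l hij hkl hik hjk hjl => hn (i, j) (k, l) (by
      simpa [hij, hkl] using hd i j k l hij hkl hik.ne (hik.trans hkl).ne hjk hjl)
  have a1 := h 0 1 2 3 (by decide) (by decide) (by decide) (by decide) (by decide)
  have a2 := h 0 2 1 3 (by decide) (by decide) (by decide) (by decide) (by decide)
  have a3 := h 0 3 1 2 (by decide) (by decide) (by decide) (by decide) (by decide)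
  have b1 := h 0 1 2 4 (by decide) (by decide) (by decide) (by decide) (by decide)
  have b2 := h 0 2 1 4 (by decide) (by decide) (by decide) (by decide) (by decide)
  have b3 := h 0 4 1 2 (by decide) (by decide) (by decide) (by decide) (by decide)
  have c1 := h 0 1 3 4 (by decide) (by decide) (by decide) (by decide) (by decide)
  have c2 := h 0 3 1 4 (by decide) (by decide) (by decide) (by decide) (by decide)
  have c3 := h 0 4 1 3 (by decide) (by decide) (by decide) (by decide) (by decide)
  have d1 := h 0 2 3 4 (by decide) (by decide) (by decide) (by decide) (by decide)
  have d2 := h 0 3 2 4 (by decide) (by decide) (by decide) (by decide) (by decide)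
  have d3 := h 0 4 2 3 (by decide) (by decide) (by decide) (by decide) (by decide)
  have e1 := h 1 2 3 4 (by decide) (by decide) (by decide) (by decide) (by decide)
  have e2 := h 1 3 2 4 (by decide) (by decide) (by decide) (by decide) (by decide)
  have e3 := h 1 4 2 3 (by decide) (by decide) (by decide) (by decide) (by decide)
  clear h hn
  norm_num at a1 a2 a3 b1 b2 b3 c1 c2 c3 d1 d2 d3 e1 e2 e3
  omega

namespace SimpleGraph

variable {V : Type u} {G : SimpleGraph V}

/-! ### Connected sets of vertices -/

/-- `x` and `y` are joined by a walk of `G` inside the set `A`. -/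
def JoinedOn (G : SimpleGraph V) (A : Set V) : V → V → Prop :=
  Relation.ReflTransGen (fun x y => G.Adj x y ∧ x ∈ A ∧ y ∈ A)

/-- Any two vertices of `A` are joined inside `A`. -/
def ConnectedOn (G : SimpleGraph V) (A : Set V) : Prop :=
  ∀ x ∈ A, ∀ y ∈ A, G.JoinedOn A x y

theorem JoinedOn.symm {A : Set V} {x y : V} (h : G.JoinedOn A x y) : G.JoinedOn A y x := by
  induction h with
  | refl => exact Relation.ReflTransGen.refl
  | tail _ h ih => exact Relation.ReflTransGen.head ⟨h.1.symm, h.2.2, h.2.1⟩ ih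

theorem JoinedOn.trans {A : Set V} {x y z : V} (h : G.JoinedOn A x y) (h' : G.JoinedOn A y z) :
    G.JoinedOn A x z := Relation.ReflTransGen.trans h h'

theorem JoinedOn.mono {A B : Set V} (hAB : A ⊆ B) {x y : V} (h : G.JoinedOn A x y) :
    G.JoinedOn B x y :=
  Relation.ReflTransGen.mono (fun _ _ h => ⟨h.1, hAB h.2.1, hAB h.2.2⟩) _ _ h

theorem JoinedOn.of_adj {A : Set V} {x y : V} (h : G.Adj x y) (hx : x ∈ A) (hy : y ∈ A) :
    G.JoinedOn A x y := Relation.ReflTransGen.single ⟨h, hx, hy⟩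

theorem JoinedOn.mem_iff {A : Set V} {x y : V} (h : G.JoinedOn A x y) : x ∈ A ↔ y ∈ A := by
  induction h with
  | refl => rfl
  | tail _ h ih => exact ih.trans (iff_of_true h.2.1 h.2.2)

theorem JoinedOn.reachable {A : Set V} {x y : V} (h : G.JoinedOn A x y) : G.Reachable x y := by
  induction h with
  | refl => rfl
  | tail _ h ih => exact ih.trans h.1.reachable

theorem ConnectedOn.of_forall_joinedOn {A : Set V} (b : V) (h : ∀ x ∈ A, G.JoinedOn A b x) :
    G.ConnectedOn A := fun x hx y hy => (h x hx).symm.trans (h y hy)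

theorem connectedOn_singleton (x : V) : G.ConnectedOn {x} := by
  rintro _ rfl _ rfl
  exact Relation.ReflTransGen.refl

theorem ConnectedOn.union_of_adj {A B : Set V} (hA : G.ConnectedOn A) (hB : G.ConnectedOn B)
    {a b : V} (ha : a ∈ A) (hb : b ∈ B) (hab : G.Adj a b) : G.ConnectedOn (A ∪ B) := by
  refine .of_forall_joinedOn a ?_
  rintro x (hx | hx)
  · exact (hA a ha x hx).mono Set.subset_union_left
  · exact (JoinedOn.of_adj hab (Or.inl ha) (Or.inr hb)).trans
      ((hB b hb x hx).mono Set.subset_union_right)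

/-! ### Regions of a drawing -/

namespace PlaneDrawing

variable (D : PlaneDrawing G)

theorem isCompact_arc {e : Sym2 V} (he : e ∈ G.edgeSet) : IsCompact (D.arc e) := by
  induction e using Sym2.ind with
  | _ u v =>
    obtain ⟨γ, -, hγ⟩ := D.isArc u v he
    rw [← hγ]
    exact isCompact_range γ.continuous

theorem isClosed_carrier [Finite V] : IsClosed D.carrier :=
  (Set.finite_range _).isClosed.union
    ((Set.toFinite _).isClosed_biUnion fun _ he => (D.isCompact_arc he).isClosed)

/-- The part of the drawing spanned by a set of vertices. -/
def region (A : Set V) : Set ℂ :=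
  {z | (∃ a ∈ A, z = D.point a) ∨ ∃ a ∈ A, ∃ b ∈ A, G.Adj a b ∧ z ∈ D.arc s(a, b)}

/-- The vertex `b` and its edges without their other ends. -/
def openStar (b : V) : Set ℂ :=
  {z | z = D.point b ∨ ∃ w, G.Adj b w ∧ z ∈ D.arc s(b, w) ∧ z ≠ D.point w}

theorem joinedIn_region {A : Set V} {x y : V} (hx : x ∈ A) (h : G.JoinedOn A x y) :
    JoinedIn (D.region A) (D.point x) (D.point y) := by
  induction h with
  | refl => exact JoinedIn.refl (Or.inl ⟨x, hx, rfl⟩)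
  | @tail a b _ h ih =>
    refine ih.trans ?_
    obtain ⟨γ, -, hγ⟩ := D.isArc a b h.1
    exact ⟨γ, fun t => Or.inr ⟨a, h.2.1, b, h.2.2, h.1, hγ ▸ ⟨t, rfl⟩⟩⟩

theorem region_subset_carrier (A : Set V) : D.region A ⊆ D.carrier := by
  rintro z (⟨a, -, rfl⟩ | ⟨a, -, b, -, hab, hz⟩)
  · exact Or.inl ⟨a, rfl⟩
  · exact Or.inr (Set.mem_biUnion (x := s(a, b)) hab hz)

theorem disjoint_region {A B : Set V} (h : Disjoint A B) :
    Disjoint (D.region A) (D.region B) := by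
  rw [Set.disjoint_left] at h ⊢
  rintro z (⟨a, ha, rfl⟩ | ⟨a, ha, a', ha', haa, hz⟩) (⟨b, hb, hzb⟩ | ⟨b, hb, b', hb', hbb, hzb⟩)
  · exact h ha (D.point_injective hzb ▸ hb)
  · rcases Sym2.mem_iff.1 (D.point_mem_arc _ hbb a hzb) with rfl | rfl
    · exact h ha hb
    · exact h ha hb'
  · subst hzb
    rcases Sym2.mem_iff.1 (D.point_mem_arc _ haa b hz) with rfl | rfl
    · exact h ha hb
    · exact h ha' hb
  · have hne : s(a, a') ≠ s(b, b') := by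
      intro e
      rcases Sym2.mem_iff.1 (e ▸ Sym2.mem_mk_left a a') with rfl | rfl
      · exact h ha hb
      · exact h ha hb'
    obtain ⟨w, hw, hw', -⟩ := D.arc_inter_arc _ haa _ hbb hne z ⟨hz, hzb⟩
    have hwA : w ∈ A := by rcases Sym2.mem_iff.1 hw with rfl | rfl <;> assumption
    have hwB : w ∈ B := by rcases Sym2.mem_iff.1 hw' with rfl | rfl <;> assumption
    exact h hwA hwB

theorem disjoint_openStar_region {A : Set V} {b : V} (hb : b ∉ A) :
    Disjoint (D.openStar b) (D.region A) := by
  rw [Set.disjoint_left]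
  rintro z (rfl | ⟨w, hbw, hz, hzw⟩) (⟨a, ha, hza⟩ | ⟨a, ha, a', ha', haa, hza⟩)
  · exact hb (D.point_injective hza ▸ ha)
  · rcases Sym2.mem_iff.1 (D.point_mem_arc _ haa b hza) with rfl | rfl
    · exact hb ha
    · exact hb ha'
  · subst hza
    rcases Sym2.mem_iff.1 (D.point_mem_arc _ hbw a hz) with rfl | rfl
    · exact hb ha
    · exact hzw rfl
  · have hne : s(b, w) ≠ s(a, a') := by
      intro e
      rcases Sym2.mem_iff.1 (e ▸ Sym2.mem_mk_left b w) with rfl | rfl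
      · exact hb ha
      · exact hb ha'
    obtain ⟨x, hx, hx', rfl⟩ := D.arc_inter_arc _ hbw _ haa hne z ⟨hz, hza⟩
    rcases Sym2.mem_iff.1 hx with rfl | rfl
    · rcases Sym2.mem_iff.1 hx' with rfl | rfl
      · exact hb ha
      · exact hb ha'
    · exact hzw rfl

theorem joinedIn_openStar {b : V} {z : ℂ} (hz : z ∈ D.openStar b) :
    JoinedIn (D.openStar b) z (D.point b) := by
  rcases hz with rfl | ⟨w, hbw, hz, hzw⟩
  · exact JoinedIn.refl (Or.inl rfl)
  · obtain ⟨γ, hinj, hγ⟩ := D.isArc b w hbw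
    rw [← hγ] at hz
    obtain ⟨s, rfl⟩ := hz
    have hs : s < 1 := by
      refine lt_of_le_of_ne unitInterval.le_one' ?_
      rintro rfl
      exact hzw γ.target
    have hsub : γ '' Set.Icc 0 s ⊆ D.openStar b := by
      rintro _ ⟨t, ht, rfl⟩
      refine Or.inr ⟨w, hbw, hγ ▸ ⟨t, rfl⟩, fun h => ?_⟩
      have : t = 1 := hinj (h.trans γ.target.symm)
      exact absurd (this ▸ ht.2) (not_le_of_gt hs)
    refine JoinedIn.mono (JoinedIn.symm ?_) hsub
    have h : JoinedIn (Set.range (γ.subpath 0 s)) (γ 0) (γ s) := ⟨γ.subpath 0 s, fun t => ⟨t, rfl⟩⟩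
    rwa [γ.range_subpath_of_le 0 s s.2.1, γ.source] at h

/-- A vertex on the boundary of a face can be reached from inside the face. -/
theorem joinedIn_face_union_openStar [Finite V] {F : Set ℂ} (hF : D.IsFace F) {z : ℂ} (hz : z ∈ F)
    {b : V} (hb : D.point b ∈ frontier F) :
    JoinedIn (F ∪ D.openStar b) z (D.point b) := by
  obtain ⟨z₀, hz₀, rfl⟩ := hF
  have hopen : IsOpen D.carrierᶜ := D.isClosed_carrier.isOpen_compl
  set F := connectedComponentIn D.carrierᶜ z₀ with hFdef
  have hFc : F ⊆ D.carrierᶜ := connectedComponentIn_subset _ _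
  have hFpath : IsPathConnected F :=
    (IsOpen.isConnected_iff_isPathConnected hopen.connectedComponentIn).1
      (isConnected_connectedComponentIn_iff.2 hz₀)
  -- A small disc around `b` avoids this closed set, so inside it the drawing consists of the open
  -- star of `b` alone.
  let rest : Set ℂ := (D.point '' {w | w ≠ b}) ∪ ⋃ e ∈ {e | e ∈ G.edgeSet ∧ b ∉ e}, D.arc e
  have hrest : IsClosed rest :=
    (Set.toFinite _).isClosed.union
      ((Set.toFinite _).isClosed_biUnion fun _ he => (D.isCompact_arc he.1).isClosed)
  have hbrest : D.point b ∈ restᶜ := by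
    rintro (⟨w, hw, h⟩ | h)
    · exact hw (D.point_injective h)
    · obtain ⟨e, he, h⟩ := Set.mem_iUnion₂.1 h
      exact he.2 (D.point_mem_arc e he.1 b h)
  have hcover : ∀ x ∈ D.carrier, x ∉ rest → x ∈ D.openStar b := by
    rintro x (⟨w, rfl⟩ | hx) hxr
    · by_cases hw : w = b
      · exact Or.inl (by rw [hw])
      · exact (hxr (Or.inl ⟨w, hw, rfl⟩)).elim
    · obtain ⟨e, he, hxe⟩ := Set.mem_iUnion₂.1 hx
      by_cases hbe : b ∈ e
      · obtain ⟨w, rfl⟩ := hbe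
        refine Or.inr ⟨w, he, hxe, ?_⟩
        rintro rfl
        exact hxr (Or.inl ⟨w, (G.ne_of_adj he).symm, rfl⟩)
      · exact (hxr (Or.inr (Set.mem_iUnion₂.2 ⟨e, ⟨he, hbe⟩, hxe⟩))).elim
  obtain ⟨ε, hε, hball⟩ := Metric.isOpen_iff.1 hrest.isOpen_compl _ hbrest
  obtain ⟨z₁, hz₁F, hz₁⟩ := Metric.mem_closure_iff.1 (frontier_subset_closure hb) ε hε
  let σ : ℝ → ℂ := fun t => AffineMap.lineMap z₁ (D.point b) t
  have hσ : Continuous σ := AffineMap.lineMap_continuous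
  have hσball : ∀ t ∈ Set.Icc (0 : ℝ) 1, σ t ∈ Metric.ball (D.point b) ε := by
    intro t ht
    refine (convex_ball _ _).segment_subset (x := z₁) (by rwa [Metric.mem_ball, _root_.dist_comm])
      (Metric.mem_ball_self hε) ?_
    rw [segment_eq_image_lineMap]
    exact ⟨t, ht, rfl⟩
  let T : Set ℝ := Set.Icc 0 1 ∩ σ ⁻¹' D.carrier
  have hT : IsCompact T := isCompact_Icc.inter_right (D.isClosed_carrier.preimage hσ)
  have h1T : (1 : ℝ) ∈ T := ⟨by simp, by
    simp only [Set.mem_preimage, σ, AffineMap.lineMap_apply_one]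
    exact Or.inl ⟨b, rfl⟩⟩
  -- The straight segment from the face towards `b` may hit an edge at `b` first. Up to the first
  -- hit it stays in the face, and from there the edge leads to `b`.
  obtain ⟨t₀, ⟨ht₀, ht₀c⟩, hmin⟩ := hT.exists_isLeast ⟨1, h1T⟩
  have hbefore : ∀ t ∈ Set.Ico 0 t₀, σ t ∈ F := by
    have hsub : σ '' Set.Ico 0 t₀ ⊆ D.carrierᶜ := by
      rintro _ ⟨t, ht, rfl⟩ hc
      exact absurd (hmin ⟨⟨ht.1, ht.2.le.trans ht₀.2⟩, hc⟩) (not_le_of_gt ht.2)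
    have h0 : 0 < t₀ := by
      refine lt_of_le_of_ne ht₀.1 ?_
      rintro rfl
      exact hFc hz₁F (by simpa [σ] using ht₀c)
    have hz₁' : z₁ ∈ σ '' Set.Ico 0 t₀ := ⟨0, ⟨le_rfl, h0⟩, by simp [σ]⟩
    have := (isPreconnected_Ico.image σ hσ.continuousOn).subset_connectedComponentIn hz₁' hsub
    rw [← connectedComponentIn_eq hz₁F] at this
    exact fun t ht => this ⟨t, ht, rfl⟩
  have hstar : σ t₀ ∈ D.openStar b := hcover _ ht₀c (hball (hσball t₀ ht₀))
  have hj₁ : JoinedIn (F ∪ D.openStar b) z z₁ :=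
    (hFpath.joinedIn z hz z₁ hz₁F).mono Set.subset_union_left
  have hj₂ : JoinedIn (F ∪ D.openStar b) z₁ (σ t₀) := by
    have hpc : IsPathConnected (σ '' Set.Icc 0 t₀) :=
      ((convex_Icc 0 t₀).isPathConnected ⟨0, le_rfl, ht₀.1⟩).image hσ
    refine (hpc.joinedIn _ ⟨0, ⟨le_rfl, ht₀.1⟩, by simp [σ]⟩ _ ⟨t₀, ⟨ht₀.1, le_rfl⟩, rfl⟩).mono ?_
    rintro _ ⟨t, ht, rfl⟩
    rcases ht.2.lt_or_eq with h | rfl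
    · exact Or.inl (hbefore t ⟨ht.1, h⟩)
    · exact Or.inr hstar
  exact (hj₁.trans hj₂).trans ((D.joinedIn_openStar hstar).mono Set.subset_union_right)

theorem disjoint_face_union_openStar_region {F : Set ℂ} (hF : D.IsFace F) {A : Set V} {b : V}
    (hb : b ∉ A) : Disjoint (F ∪ D.openStar b) (D.region A) := by
  refine Disjoint.union_left ?_ (D.disjoint_openStar_region hb)
  obtain ⟨z₀, -, rfl⟩ := hF
  exact Set.disjoint_left.2 fun z hz hzA =>
    connectedComponentIn_subset _ _ hz (D.region_subset_carrier A hzA)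

end PlaneDrawing

/-! ### Excluded minors of outerplanar graphs -/

/-- A point `z` of the face is the third vertex on the other side of a `K₃,₃`. The sets `F ∪
D.openStar (w j)` overlap, but only edges without a common end have to be disjoint. -/
theorem IsOuterplanar.not_exists_completeBipartite_two_three_minor [Finite V]
    (hG : G.IsOuterplanar) {A₁ A₂ : Set V} (hA₁ : G.ConnectedOn A₁) (hA₂ : G.ConnectedOn A₂)
    (hA : Disjoint A₁ A₂) {w : Fin 3 → V} (hw : Function.Injective w) (hw₁ : ∀ j, w j ∉ A₁)
    (hw₂ : ∀ j, w j ∉ A₂) (h₁ : ∀ j, ∃ a ∈ A₁, G.Adj a (w j)) (h₂ : ∀ j, ∃ a ∈ A₂, G.Adj a (w j)) :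
    False := by
  obtain ⟨D, F, ⟨hF, -⟩, hfr⟩ := hG
  obtain ⟨z, hz⟩ : F.Nonempty := by
    obtain ⟨z, hz, rfl⟩ := hF
    exact ⟨z, mem_connectedComponentIn hz⟩
  obtain ⟨a₁, ha₁, -⟩ := h₁ 0
  obtain ⟨a₂, ha₂, -⟩ := h₂ 0
  have hc : ∀ {A : Set V} {a : V} (_ : a ∈ A) (_ : G.ConnectedOn A)
      (_ : ∀ j, ∃ a ∈ A, G.Adj a (w j)) (j : Fin 3),
      JoinedIn (D.region (A ∪ {w j})) (D.point a) (D.point (w j)) := by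
    intro A a ha hA h j
    obtain ⟨a', ha', hadj⟩ := h j
    exact D.joinedIn_region (Or.inl ha) (hA.union_of_adj (connectedOn_singleton (w j)) ha' rfl hadj
      _ (Or.inl ha) _ (Or.inr rfl))
  have hd₁₂ : ∀ j l, j ≠ l → Disjoint (D.region (A₁ ∪ {w j})) (D.region (A₂ ∪ {w l})) := by
    intro j l hjl
    refine D.disjoint_region (Set.disjoint_left.2 ?_)
    rintro x (hx | rfl) (hx' | hx')
    · exact Set.disjoint_left.1 hA hx hx'
    · exact hw₁ l (hx' ▸ hx)
    · exact hw₂ j hx'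
    · exact hjl (hw hx')
  have hd₃ : ∀ {A : Set V} (_ : ∀ j, w j ∉ A) (j l : Fin 3), j ≠ l →
      Disjoint (F ∪ D.openStar (w j)) (D.region (A ∪ {w l})) := by
    intro A hA j l hjl
    refine D.disjoint_face_union_openStar_region hF ?_
    rintro (h | h)
    · exact hA j h
    · exact hjl (hw h)
  refine not_exists_drawing_completeBipartite_three ![D.point a₁, D.point a₂, z]
    (fun j => D.point (w j))
    (fun i j => ![D.region (A₁ ∪ {w j}), D.region (A₂ ∪ {w j}), F ∪ D.openStar (w j)] i) ?_ ?_
  · intro i j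
    fin_cases i
    · exact hc ha₁ hA₁ h₁ j
    · exact hc ha₂ hA₂ h₂ j
    · exact D.joinedIn_face_union_openStar hF hz (hfr (w j))
  · intro i j k l hik hjl
    fin_cases i <;> fin_cases k
    · exact (hik rfl).elim
    · exact hd₁₂ j l hjl
    · exact (hd₃ hw₁ l j hjl.symm).symm
    · exact (hd₁₂ l j hjl.symm).symm
    · exact (hik rfl).elim
    · exact (hd₃ hw₂ l j hjl.symm).symm
    · exact hd₃ hw₁ j l hjl
    · exact hd₃ hw₂ j l hjl
    · exact (hik rfl).elim

/-- A point of the face becomes the fifth vertex of a `K₅`, joined to one chosen vertex of each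
branch set. -/
theorem IsOuterplanar.not_exists_complete_four_minor [Finite V]
    (hG : G.IsOuterplanar) {B : Fin 4 → Set V} (hB : ∀ i, G.ConnectedOn (B i))
    (hd : ∀ i j, i ≠ j → Disjoint (B i) (B j))
    (hadj : ∀ i j, i < j → ∃ a ∈ B i, ∃ b ∈ B j, G.Adj a b) : False := by
  obtain ⟨D, F, ⟨hF, -⟩, hfr⟩ := hG
  obtain ⟨z, hz⟩ : F.Nonempty := by
    obtain ⟨z, hz, rfl⟩ := hF
    exact ⟨z, mem_connectedComponentIn hz⟩
  have hne : ∀ i, (B i).Nonempty := by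
    intro i
    rcases eq_or_ne i 0 with rfl | hi
    · obtain ⟨a, ha, -⟩ := hadj 0 1 (by decide)
      exact ⟨a, ha⟩
    · obtain ⟨-, -, b, hb, -⟩ := hadj 0 i (Fin.pos_iff_ne_zero.2 hi)
      exact ⟨b, hb⟩
  choose b hb using hne
  refine not_exists_drawing_complete_five (Fin.cons z fun i => D.point (b i))
    (Fin.cons (Fin.cons ∅ fun j => F ∪ D.openStar (b j))
      fun i => Fin.cons ∅ fun j => D.region (B i ∪ B j)) ?_ ?_
  · intro i j hij
    induction j using Fin.cases with
    | zero => exact absurd hij (Fin.not_lt_zero i)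
    | succ j =>
      induction i using Fin.cases with
      | zero => exact D.joinedIn_face_union_openStar hF hz (hfr (b j))
      | succ i =>
        obtain ⟨x, hx, y, hy, hxy⟩ := hadj i j (Fin.succ_lt_succ_iff.1 hij)
        exact D.joinedIn_region (Or.inl (hb i))
          ((hB i).union_of_adj (hB j) hx hy hxy _ (Or.inl (hb i)) _ (Or.inr (hb j)))
  · have hdF : ∀ j k l, j ≠ k → j ≠ l →
        Disjoint (F ∪ D.openStar (b j)) (D.region (B k ∪ B l)) := by
      intro j k l hjk hjl
      refine D.disjoint_face_union_openStar_region hF ?_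
      rintro (h | h)
      · exact Set.disjoint_left.1 (hd j k hjk) (hb j) h
      · exact Set.disjoint_left.1 (hd j l hjl) (hb j) h
    intro i j k l hij hkl hik hil hjk hjl
    induction j using Fin.cases with
    | zero => exact absurd hij (Fin.not_lt_zero i)
    | succ j =>
    induction l using Fin.cases with
    | zero => exact absurd hkl (Fin.not_lt_zero k)
    | succ l =>
    have hjl' : j ≠ l := fun h => hjl (by rw [h])
    induction i using Fin.cases with
    | zero =>
      induction k using Fin.cases with
      | zero => exact (hik rfl).elim
      | succ k => exact hdF j k l (fun h => hjk (by rw [h])) hjl'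
    | succ i =>
      have hil' : i ≠ l := fun h => hil (by rw [h])
      induction k using Fin.cases with
      | zero => exact (hdF l i j hil'.symm hjl'.symm).symm
      | succ k =>
        have hik' : i ≠ k := fun h => hik (by rw [h])
        have hjk' : j ≠ k := fun h => hjk (by rw [h])
        refine D.disjoint_region (Disjoint.union_left ?_ ?_)
        · exact (hd i k hik').union_right (hd i l hil')
        · exact (hd j k hjk').union_right (hd j l hjl')

theorem JoinedOn.joinedOn_class {A : Set V} {x y : V} (h : G.JoinedOn A x y) :
    G.JoinedOn {z | G.JoinedOn A x z} x y := by
  induction h with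
  | refl => exact Relation.ReflTransGen.refl
  | tail h h' ih => exact ih.tail ⟨h'.1, h, h.tail h'⟩

/-! ### Layerings and their torsos -/

/-- A partition of the vertices into breadth-first layers from one root in every component. -/
structure IsLayering (G : SimpleGraph V) (l : V → ℕ) : Prop where
  le_of_adj : ∀ a b, G.Adj a b → l a ≤ l b + 1
  exists_adj : ∀ a, l a ≠ 0 → ∃ b, G.Adj b a ∧ l b + 1 = l a
  eq_of_reachable : ∀ a b, G.Reachable a b → l a = 0 → l b = 0 → a = b

/-- The vertices of the component of `u` in the layers above `u`. -/
def upperSide (G : SimpleGraph V) (l : V → ℕ) (u : V) : Set V :=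
  {x | G.Reachable x u ∧ l x < l u}

/-- The union of the components below the layer of `u` to which `u` is attached. -/
def lowerSide (G : SimpleGraph V) (l : V → ℕ) (u : V) : Set V :=
  {x | ∃ y, G.Adj u y ∧ l u < l y ∧ G.JoinedOn {z | l u < l z} y x}

/-- Two vertices of a layer are adjacent in the torso if they are adjacent or attached to the same
component of the lower layers. -/
def layerTorso (G : SimpleGraph V) (l : V → ℕ) : SimpleGraph V where
  Adj a b := a ≠ b ∧ l a = l b ∧ (G.Adj a b ∨ (G.lowerSide l a ∩ G.lowerSide l b).Nonempty)
  symm := ⟨fun _ _ h => ⟨h.1.symm, h.2.1.symm, h.2.2.imp (fun h => h.symm) fun h => Set.inter_comm _ _ ▸ h⟩⟩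
  loopless := ⟨fun _ h => h.1 rfl⟩

section

variable {l : V → ℕ}

theorem lt_of_mem_lowerSide {u x : V} (h : x ∈ G.lowerSide l u) : l u < l x := by
  obtain ⟨y, -, hy, hyx⟩ := h
  exact hyx.mem_iff.1 hy

theorem mem_lowerSide_of_joinedOn {u x y : V} (h : x ∈ G.lowerSide l u)
    (hxy : G.JoinedOn {z | l u < l z} x y) : y ∈ G.lowerSide l u := by
  obtain ⟨z, h₁, h₂, h₃⟩ := h
  exact ⟨z, h₁, h₂, h₃.trans hxy⟩

theorem reachable_of_mem_lowerSide {u x : V} (h : x ∈ G.lowerSide l u) : G.Reachable u x := by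
  obtain ⟨z, h₁, h₂, h₃⟩ := h
  exact h₁.reachable.trans h₃.reachable

/-- The whole component of `x` below the layer belongs to both lower sides, so a neighbour of `w` in
that component can be reached without leaving their intersection. -/
theorem joinedOn_lowerSide {u w x : V} (hl : l u = l w) (hu : x ∈ G.lowerSide l u)
    (hw : x ∈ G.lowerSide l w) :
    ∃ y ∈ G.lowerSide l u ∩ G.lowerSide l w, G.Adj w y ∧
      G.JoinedOn (G.lowerSide l u ∩ G.lowerSide l w) y x := by
  have hw' := hw
  obtain ⟨y, h₁, h₂, h₃⟩ := hw'
  have hsub : {z | G.JoinedOn {z | l w < l z} x z} ⊆ G.lowerSide l u ∩ G.lowerSide l w :=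
    fun z hz => ⟨mem_lowerSide_of_joinedOn hu (by rwa [hl]), mem_lowerSide_of_joinedOn hw hz⟩
  exact ⟨y, hsub h₃.symm, h₁, (h₃.symm.joinedOn_class.mono hsub).symm⟩

theorem connectedOn_insert_lowerSide (u : V) : G.ConnectedOn ({u} ∪ G.lowerSide l u) := by
  refine .of_forall_joinedOn u ?_
  rintro x (rfl | hx)
  · exact Relation.ReflTransGen.refl
  · obtain ⟨y, hy, hadj, h⟩ := joinedOn_lowerSide rfl hx hx
    exact (JoinedOn.of_adj hadj (Or.inl rfl) (Or.inr hy.1)).trans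
      (h.mono (Set.inter_subset_left.trans Set.subset_union_right))

theorem layerTorso_adj_cases {u w : V} (h : (G.layerTorso l).Adj u w) :
    G.Adj w u ∨ ∃ z ∈ G.lowerSide l u ∩ G.lowerSide l w, G.Adj w z := by
  obtain ⟨-, hl, h | ⟨z, hz⟩⟩ := h
  · exact Or.inl h.symm
  · obtain ⟨y, hy, hadj, -⟩ := joinedOn_lowerSide hl hz.1 hz.2
    exact Or.inr ⟨y, hy, hadj⟩

theorem exists_adj_of_layerTorso_adj {u w : V} (h : (G.layerTorso l).Adj u w) :
    ∃ a ∈ {u} ∪ G.lowerSide l u, G.Adj a w := by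
  rcases layerTorso_adj_cases h with h | ⟨z, hz, h⟩
  · exact ⟨u, Or.inl rfl, h.symm⟩
  · exact ⟨z, Or.inr hz.1, h.symm⟩

theorem reachable_of_layerTorso_adj {u w : V} (h : (G.layerTorso l).Adj u w) :
    G.Reachable u w := by
  obtain ⟨-, hl, h | ⟨z, hz⟩⟩ := h
  · exact h.reachable
  · exact (reachable_of_mem_lowerSide hz.1).trans (reachable_of_mem_lowerSide hz.2).symm

theorem reachable_of_layerTorso_walk {u w : V} (p : (G.layerTorso l).Walk u w) :
    G.Reachable u w ∧ l u = l w := by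
  induction p with
  | nil => exact ⟨Reachable.rfl, rfl⟩
  | cons h _ ih => exact ⟨(reachable_of_layerTorso_adj h).trans ih.1, h.2.1.trans ih.2⟩

theorem connectedOn_layerTorso_walk {u w : V} (p : (G.layerTorso l).Walk u w) :
    G.ConnectedOn {x | ∃ m ∈ p.support, x ∈ {m} ∪ G.lowerSide l m} := by
  induction p with
  | @nil u =>
    convert connectedOn_insert_lowerSide (G := G) (l := l) u using 1
    ext x; simp
  | @cons u v w h p ih =>
    obtain ⟨a, ha, hadj⟩ := exists_adj_of_layerTorso_adj h
    convert (connectedOn_insert_lowerSide (G := G) (l := l) u).union_of_adj ih ha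
      ⟨v, p.start_mem_support, Or.inl rfl⟩ hadj using 1
    ext x
    simp only [Walk.support_cons, List.mem_cons, Set.mem_ofPred_eq, Set.mem_union, exists_eq_or_imp]

/-! ### Torsos of outerplanar graphs have maximum degree two and no cycles -/

namespace IsLayering

variable (hl : G.IsLayering l)
include hl

theorem exists_root (w : V) :
    ∃ r, l r = 0 ∧ G.JoinedOn {x | G.Reachable x w ∧ l x ≤ l w} r w := by
  generalize hn : l w = n
  induction n generalizing w with
  | zero => exact ⟨w, hn, Relation.ReflTransGen.refl⟩
  | succ n ih =>
    obtain ⟨b, hb, hbl⟩ := hl.exists_adj w (by omega)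
    obtain ⟨r, hr, hrb⟩ := ih b (by omega)
    refine ⟨r, hr, JoinedOn.trans (y := b) (hrb.mono ?_)
      (.of_adj hb ⟨hb.reachable, by omega⟩ ⟨Reachable.rfl, by omega⟩)⟩
    rintro x ⟨hx, hx'⟩
    exact ⟨hx.trans hb.reachable, by omega⟩

/-- Each vertex climbs through ever smaller layers to a root, and the component has only one root.
-/
theorem connectedOn_upperSide (u : V) : G.ConnectedOn (G.upperSide l u) := by
  have key : ∀ x ∈ G.upperSide l u, ∃ r, l r = 0 ∧ G.JoinedOn (G.upperSide l u) r x := by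
    intro x hx
    obtain ⟨r, hr, hrx⟩ := hl.exists_root x
    refine ⟨r, hr, hrx.mono ?_⟩
    rintro y ⟨hy, hy'⟩
    exact ⟨hy.trans hx.1, hy'.trans_lt hx.2⟩
  intro x hx y hy
  obtain ⟨r, hr, hrx⟩ := key x hx
  obtain ⟨s, hs, hsy⟩ := key y hy
  obtain rfl := hl.eq_of_reachable r s
    (hrx.reachable.trans (hx.1.trans (hsy.reachable.trans hy.1).symm)) hr hs
  exact hrx.symm.trans hsy

theorem exists_adj_upperSide {u w : V} (hr : G.Reachable w u) (h : l w = l u) (h0 : l u ≠ 0) :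
    ∃ a ∈ G.upperSide l u, G.Adj a w := by
  obtain ⟨b, hb, hbl⟩ := hl.exists_adj w (h.trans_ne h0)
  exact ⟨b, ⟨hb.reachable.trans hr, by omega⟩, hb⟩

/-- The connected part above the layer is adjacent to all three vertices as well, so with `A` it
forms a `K₂,₃` minor. Layer 0 is excluded because a component has only one vertex there. -/
theorem false_of_three_common_neighbors [Finite V] (hG : G.IsOuterplanar) {j : ℕ} {A : Set V}
    (hA : G.ConnectedOn A) (hAj : ∀ x ∈ A, j ≤ l x) {w : Fin 3 → V} (hw : Function.Injective w)
    (hwj : ∀ i, l (w i) = j) (hwA : ∀ i, w i ∉ A) (hadj : ∀ i, ∃ a ∈ A, G.Adj a (w i)) : False := by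
  have hr : ∀ i, G.Reachable (w i) (w 0) := by
    intro i
    obtain ⟨a, ha, h⟩ := hadj i
    obtain ⟨b, hb, h'⟩ := hadj 0
    exact (h.symm.reachable.trans (hA a ha b hb).reachable).trans h'.reachable
  have hj : j ≠ 0 := by
    rintro rfl
    exact absurd (hw (hl.eq_of_reachable _ _ (hr 1) (hwj 1) (hwj 0))) (by decide)
  refine hG.not_exists_completeBipartite_two_three_minor (hl.connectedOn_upperSide (w 0)) hA
    (Set.disjoint_left.2 fun x hx hxA => ?_) hw (fun i h => ?_) hwA (fun i => ?_) hadj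
  · have := hx.2
    have := hAj x hxA
    have := hwj 0
    omega
  · have := h.2
    have := hwj 0
    have := hwj i
    omega
  · exact hl.exists_adj_upperSide (hr i) ((hwj i).trans (hwj 0).symm) ((hwj 0).trans_ne hj)

theorem not_mem_three_lowerSides [Finite V] (hG : G.IsOuterplanar) {a b c z : V} (hab : a ≠ b)
    (hac : a ≠ c) (hbc : b ≠ c) (hlb : l b = l a) (hlc : l c = l a) (ha : z ∈ G.lowerSide l a)
    (hb : z ∈ G.lowerSide l b) (hc : z ∈ G.lowerSide l c) : False := by
  refine hl.false_of_three_common_neighbors hG (j := l a)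
    (A := {x | G.JoinedOn {x | l a < l x} z x})
    (.of_forall_joinedOn z fun x hx => hx.joinedOn_class)
    (fun x hx => (hx.mem_iff.1 (lt_of_mem_lowerSide ha)).le) (w := ![a, b, c]) ?_ ?_ ?_ ?_
  · intro i k h
    fin_cases i <;> fin_cases k <;> first | rfl | (simp at h; grind)
  · intro i
    fin_cases i
    exacts [rfl, hlb, hlc]
  · intro i h
    have := h.mem_iff.1 (lt_of_mem_lowerSide ha)
    fin_cases i
    · exact absurd this (lt_irrefl (l a))
    · exact this.ne hlb.symm
    · exact this.ne hlc.symm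
  · have key : ∀ x, l x = l a → z ∈ G.lowerSide l x →
        ∃ y ∈ {x | G.JoinedOn {x | l a < l x} z x}, G.Adj y x := by
      rintro x hx ⟨y, h₁, h₂, h₃⟩
      rw [hx] at h₃
      exact ⟨y, h₃.symm, h₁.symm⟩
    intro i
    fin_cases i
    exacts [key a rfl ha, key b hlb hb, key c hlc hc]

theorem layerTorso_neighbors [Finite V] (hG : G.IsOuterplanar) {u : V} {w : Fin 3 → V}
    (hw : ∀ i, (G.layerTorso l).Adj u (w i)) : ¬ Function.Injective w := by
  intro hinj
  refine hl.false_of_three_common_neighbors hG (j := l u) (connectedOn_insert_lowerSide u)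
    ?_ hinj (fun i => (hw i).2.1.symm) ?_ fun i => exists_adj_of_layerTorso_adj (hw i)
  · rintro x (rfl | hx)
    · exact le_rfl
    · exact (lt_of_mem_lowerSide hx).le
  · rintro i (h | h)
    · exact (hw i).1 h.symm
    · exact (lt_of_mem_lowerSide h).ne (hw i).2.1

open Classical in
-- If a torso edge `uw` lies on a cycle, a `K₄` minor arises from the part above the layer, `u`, `w`
-- with the components attached to both `u` and `w`, and the rest of the cycle with everything
-- hanging below it. A component shared by the last two sets would be attached to three vertices of
-- the layer.
theorem isAcyclic_layerTorso [Finite V] (hG : G.IsOuterplanar) : (G.layerTorso l).IsAcyclic := by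
  rw [isAcyclic_iff_forall_adj_isBridge]
  intro u w huw
  rw [isBridge_iff]
  intro hr
  have hle : (G.layerTorso l).deleteEdges {s(u, w)} ≤ G.layerTorso l := deleteEdges_le _
  obtain ⟨p, hp⟩ := hr.exists_isPath
  cases p with
  | nil => exact huw.1 rfl
  | @cons _ x _ hux p =>
  have hup := (Walk.cons_isPath_iff _ _).1 hp
  have hxw : x ≠ w := by
    rintro rfl
    simp [deleteEdges_adj] at hux
  obtain ⟨p', hp', hp''⟩ : ∃ p' : ((G.layerTorso l).deleteEdges {s(u, w)}).Walk w x,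
      p'.IsPath ∧ u ∉ p'.support :=
    ⟨p.reverse, hup.1.reverse, by simpa using hup.2⟩
  cases p' with
  | nil => exact hxw rfl
  | @cons _ y _ hwy q =>
  have hwq := ((Walk.cons_isPath_iff _ _).1 hp').2
  have huq : u ∉ q.support := fun h => hp'' (by simp [h])
  have hux' := hle hux
  have hwy' := hle hwy
  obtain ⟨q', hq'⟩ : ∃ q' : (G.layerTorso l).Walk y x, q'.support = q.support :=
    ⟨q.mapLe hle, by simp⟩
  rw [← hq'] at hwq huq
  have hm : ∀ m ∈ q'.support, G.Reachable m u ∧ l m = l u := by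
    intro m hm
    have h := reachable_of_layerTorso_walk (q'.dropUntil m hm)
    exact ⟨h.1.trans (reachable_of_layerTorso_adj hux').symm, h.2.trans hux'.2.1.symm⟩
  have hru := (reachable_of_layerTorso_adj huw).symm
  have h0 : l u ≠ 0 := fun h => huw.1 (hl.eq_of_reachable _ _ hru.symm h (huw.2.1 ▸ h))
  set U := G.upperSide l u with hU
  set B := G.lowerSide l u ∩ G.lowerSide l w with hB
  set M := {z | ∃ m ∈ q'.support, z ∈ {m} ∪ G.lowerSide l m} with hM
  have hMl : ∀ z ∈ M, l u ≤ l z := by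
    rintro z ⟨m, hmq, rfl | hz⟩
    · exact (hm z hmq).2.ge
    · exact (hm m hmq).2 ▸ (lt_of_mem_lowerSide hz).le
  have hBl : ∀ z ∈ {w} ∪ B, l u ≤ l z := by
    rintro z (rfl | hz)
    · exact huw.2.1.le
    · exact (lt_of_mem_lowerSide hz.1).le
  have hBc : G.ConnectedOn ({w} ∪ B) := by
    refine .of_forall_joinedOn w ?_
    rintro z (rfl | hz)
    · exact Relation.ReflTransGen.refl
    · obtain ⟨v, hv, hadj, h⟩ := joinedOn_lowerSide huw.2.1 hz.1 hz.2
      exact (JoinedOn.of_adj hadj (Or.inl rfl) (Or.inr hv)).trans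
        (h.mono Set.subset_union_right)
  have hUd : ∀ A : Set V, (∀ z ∈ A, l u ≤ l z) → Disjoint U A := fun A hA =>
    Set.disjoint_left.2 fun z hz hzA => absurd hz.2 (hA z hzA).not_gt
  have huB : Disjoint {u} ({w} ∪ B) := by
    rw [Set.disjoint_singleton_left]
    rintro (h | h)
    · exact huw.1 h
    · exact (lt_of_mem_lowerSide h.1).ne rfl
  have huM : Disjoint {u} M := by
    rw [Set.disjoint_singleton_left]
    rintro ⟨m, hmq, rfl | h⟩
    · exact huq hmq
    · exact (lt_of_mem_lowerSide h).ne (hm m hmq).2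
  have hBM : Disjoint ({w} ∪ B) M := by
    rw [Set.disjoint_left]
    rintro z (rfl | hz) ⟨m, hmq, rfl | h⟩
    · exact hwq hmq
    · exact (lt_of_mem_lowerSide h).ne ((hm m hmq).2.trans huw.2.1)
    · exact (lt_of_mem_lowerSide hz.1).ne (hm z hmq).2.symm
    · exact hl.not_mem_three_lowerSides hG huw.1 (ne_of_mem_of_not_mem hmq huq).symm
        (ne_of_mem_of_not_mem hmq hwq).symm
        huw.2.1.symm (hm m hmq).2 hz.1 hz.2 h
  have hyM : y ∈ M := ⟨y, q'.start_mem_support, Or.inl rfl⟩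
  refine hG.not_exists_complete_four_minor (B := ![U, {u}, {w} ∪ B, M]) ?_ ?_ ?_
  · intro i
    fin_cases i
    exacts [hl.connectedOn_upperSide u, connectedOn_singleton u, hBc,
      connectedOn_layerTorso_walk q']
  · have h01 := hUd {u} (by rintro _ rfl; exact le_rfl)
    have h02 := hUd _ hBl
    have h03 := hUd _ hMl
    intro i j hij
    fin_cases i <;> fin_cases j <;>
      first
        | exact (hij rfl).elim
        | assumption
        | (apply Disjoint.symm; assumption)
  · have h01 : ∃ a ∈ U, ∃ b ∈ ({u} : Set V), G.Adj a b := by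
      obtain ⟨a, ha, h⟩ := hl.exists_adj_upperSide Reachable.rfl rfl h0
      exact ⟨a, ha, u, rfl, h⟩
    have h02 : ∃ a ∈ U, ∃ b ∈ {w} ∪ B, G.Adj a b := by
      obtain ⟨a, ha, h⟩ := hl.exists_adj_upperSide hru huw.2.1.symm h0
      exact ⟨a, ha, w, Or.inl rfl, h⟩
    have h03 : ∃ a ∈ U, ∃ b ∈ M, G.Adj a b := by
      have := hm y q'.start_mem_support
      obtain ⟨a, ha, h⟩ := hl.exists_adj_upperSide this.1 this.2 h0
      exact ⟨a, ha, y, hyM, h⟩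
    have h12 : ∃ a ∈ ({u} : Set V), ∃ b ∈ {w} ∪ B, G.Adj a b := by
      rcases layerTorso_adj_cases huw.symm with h | ⟨z, hz, h⟩
      · exact ⟨u, rfl, w, Or.inl rfl, h⟩
      · exact ⟨u, rfl, z, Or.inr hz.symm, h⟩
    have h13 : ∃ a ∈ ({u} : Set V), ∃ b ∈ M, G.Adj a b := by
      obtain ⟨a, ha, h⟩ := exists_adj_of_layerTorso_adj hux'.symm
      exact ⟨u, rfl, a, ⟨x, q'.end_mem_support, ha⟩, h.symm⟩
    have h23 : ∃ a ∈ {w} ∪ B, ∃ b ∈ M, G.Adj a b := by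
      obtain ⟨a, ha, h⟩ := exists_adj_of_layerTorso_adj hwy'.symm
      exact ⟨w, Or.inl rfl, a, ⟨y, q'.start_mem_support, ha⟩, h.symm⟩
    intro i j hij
    fin_cases i <;> fin_cases j <;>
      first
        | exact absurd hij (by decide)
        | assumption

end IsLayering

end

/-! ### Disjoint unions of paths -/

open Classical in
-- A longest path admits no neighbour outside it: at an end it could be extended, at an inner vertex
-- the degree would be three. By connectedness it covers the tree, and by acyclicity it has no
-- chords.
theorem IsTree.exists_iso_pathGraph [Finite V] (hT : G.IsTree)
    (hdeg : ∀ (u : V) (w : Fin 3 → V), (∀ i, G.Adj u (w i)) → ¬ Function.Injective w) :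
    ∃ n, Nonempty (G ≃g pathGraph n) := by
  have := Fintype.ofFinite V
  obtain ⟨u, v, p, hp, hmax⟩ : ∃ (u v : V) (p : G.Walk u v), p.IsPath ∧
      ∀ (u' v' : V) (p' : G.Walk u' v'), p'.IsPath → p'.length ≤ p.length := by
    let s : Set ℕ := {n | ∃ (u v : V) (p : G.Walk u v), p.IsPath ∧ p.length = n}
    have hbdd : BddAbove s := ⟨Fintype.card V, by rintro _ ⟨u, v, p, hp, rfl⟩; exact hp.length_lt.le⟩
    obtain ⟨x⟩ := hT.1.nonempty
    obtain ⟨u, v, p, hp, hlen⟩ := Nat.sSup_mem (s := s) ⟨0, x, x, .nil, .nil, rfl⟩ hbdd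
    exact ⟨u, v, p, hp, fun u' v' p' hp' => hlen ▸ le_csSup hbdd ⟨u', v', p', hp', rfl⟩⟩
  have hinj : ∀ {i j : ℕ}, i ≤ p.length → j ≤ p.length → p.getVert i = p.getVert j → i = j :=
    fun hi hj h => hp.getVert_injOn hi hj h
  have hclosed : ∀ x y, x ∈ p.support → G.Adj x y → y ∈ p.support := by
    intro x y hx hxy
    by_contra hy
    obtain ⟨i, rfl, hi⟩ := Walk.mem_support_iff_exists_getVert.1 hx
    rcases Nat.eq_zero_or_pos i with rfl | hi0
    · rw [Walk.getVert_zero] at hxy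
      have := hmax _ _ _ (hp.cons (h := hxy.symm) hy)
      simp at this
    rcases hi.eq_or_lt with rfl | hil
    · rw [Walk.getVert_length] at hxy
      have := hmax _ _ _ (hp.concat hy hxy)
      simp at this
    obtain ⟨i, rfl⟩ := Nat.exists_eq_succ_of_ne_zero hi0.ne'
    refine hdeg (p.getVert (i + 1)) ![p.getVert i, p.getVert (i + 2), y] ?_ ?_
    · intro k
      fin_cases k
      exacts [(p.adj_getVert_succ (by omega)).symm, p.adj_getVert_succ hil, hxy]
    · have h1 : p.getVert i ≠ p.getVert (i + 2) := fun h => by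
        have := hinj (by omega) (by omega) h
        omega
      have h2 : ∀ k, p.getVert k ≠ y := fun k h => hy (h ▸ p.getVert_mem_support k)
      have h3 := h2 i
      have h4 := h2 (i + 2)
      intro k k' h
      fin_cases k <;> fin_cases k' <;> first | rfl | (simp at h; grind)
  have hall : ∀ x, x ∈ p.support := by
    intro x
    obtain ⟨q⟩ := hT.1.preconnected u x
    have : ∀ {a b : V} (q : G.Walk a b), a ∈ p.support → b ∈ p.support := by
      intro a b q
      induction q with
      | nil => exact id
      | cons h _ ih => exact fun ha => ih (hclosed _ _ ha h)
    exact this q p.start_mem_support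
  have hadj : ∀ {i j : ℕ}, i < j → j ≤ p.length → G.Adj (p.getVert i) (p.getVert j) → i + 1 = j := by
    intro i j hij hj h
    have hmem : p.getVert j ∈ (p.drop i).support := by
      rw [Walk.mem_support_iff_exists_getVert]
      exact ⟨j - i, by rw [Walk.drop_getVert]; congr 1; omega, by rw [Walk.drop_length]; omega⟩
    have := hT.2.eq_snd_of_adj_start (hp.drop i) h hmem
    rw [Walk.snd, Walk.drop_getVert] at this
    exact (hinj hj (by omega) this).symm
  let f : Fin (p.length + 1) ≃ V := Equiv.ofBijective (fun i => p.getVert i)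
    ⟨fun i j h => Fin.ext (hinj (by omega) (by omega) h), fun x => by
      obtain ⟨i, h, hi⟩ := Walk.mem_support_iff_exists_getVert.1 (hall x)
      exact ⟨⟨i, by omega⟩, h⟩⟩
  refine ⟨p.length + 1, ⟨RelIso.symm ⟨f, ?_⟩⟩⟩
  intro i j
  rw [pathGraph_adj]
  constructor
  · intro h
    have hne : i.val ≠ j.val := fun e => h.ne (congrArg f (Fin.ext e))
    rcases lt_or_gt_of_ne hne with hlt | hlt
    · exact Or.inl (hadj hlt (by omega) h)
    · exact Or.inr (hadj hlt (by omega) h.symm)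
  · rintro (h | h)
    · have := p.adj_getVert_succ (i := i) (by omega)
      rwa [h] at this
    · have := p.adj_getVert_succ (i := j) (by omega)
      rw [h] at this
      exact this.symm

theorem IsAcyclic.isDisjointUnionOfPaths [Finite V] (hG : G.IsAcyclic)
    (hdeg : ∀ (u : V) (w : Fin 3 → V), (∀ i, G.Adj u (w i)) → ¬ Function.Injective w) :
    G.IsDisjointUnionOfPaths := fun c =>
  (hG.isTree_connectedComponent c).exists_iso_pathGraph fun u w hw hinj =>
    hdeg u (fun i => w i) hw (Subtype.val_injective.comp hinj)

theorem IsDisjointUnionOfPaths.exists_position (hG : G.IsDisjointUnionOfPaths) :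
    ∃ pos : V → ℕ, (∀ a b, G.Adj a b → pos a + 1 = pos b ∨ pos b + 1 = pos a) ∧
      ∀ a b, G.Reachable a b → pos a = pos b → a = b := by
  choose n φ using hG
  let ψ := fun c => (φ c).some
  let pos : V → ℕ := fun a => (ψ (G.connectedComponentMk a) ⟨a, rfl⟩).val
  have hpos : ∀ c a (ha : a ∈ c.supp), pos a = (ψ c ⟨a, ha⟩).val := by
    rintro c a rfl
    rfl
  refine ⟨pos, fun a b hab => ?_, fun a b hab h => ?_⟩
  · have hb : b ∈ (G.connectedComponentMk a).supp := ConnectedComponent.sound hab.symm.reachable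
    rw [hpos _ a rfl, hpos _ b hb]
    exact pathGraph_adj.1 ((ψ _).map_adj_iff.2 hab)
  · have hb : b ∈ (G.connectedComponentMk a).supp := ConnectedComponent.sound hab.symm
    rw [hpos _ a rfl, hpos _ b hb] at h
    exact congrArg Subtype.val ((ψ _).injective (Fin.ext h))

/-! ### Breadth-first layers -/

theorem Reachable.dist_le_succ {r a b : V} (h : G.Reachable r b) (hab : G.Adj a b) :
    G.dist r a ≤ G.dist r b + 1 := by
  obtain ⟨p, hp⟩ := h.exists_walk_length_eq_dist
  rw [← hp, ← Walk.length_concat p hab.symm]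
  exact dist_le _

theorem isLayering_dist (root : V → V) (h₁ : ∀ a b, G.Adj a b → root a = root b)
    (h₂ : ∀ a, G.Reachable (root a) a) : G.IsLayering fun a => G.dist (root a) a where
  le_of_adj a b h := by
    rw [h₁ a b h]
    exact (h₂ b).dist_le_succ h
  exists_adj a ha := by
    obtain ⟨p, hp⟩ := (h₂ a).symm.exists_walk_length_eq_dist
    rw [SimpleGraph.dist_comm] at hp
    generalize hr : root a = r at p hp
    cases p with
    | nil => exact (ha (by rw [hr, SimpleGraph.dist_self])).elim
    | @cons _ b _ h p =>
      have hrb : root b = r := (h₁ a b h).symm.trans hr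
      have hd := dist_le p
      have hd' := (h₂ b).dist_le_succ h
      rw [SimpleGraph.dist_comm] at hd
      rw [Walk.length_cons] at hp
      rw [hrb] at hd'
      exact ⟨b, h.symm, by rw [hrb]; omega⟩
  eq_of_reachable a b h ha hb := by
    have hroot : root a = root b := by
      obtain ⟨p⟩ := h
      clear ha hb
      induction p with
      | nil => rfl
      | cons h _ ih => exact (h₁ _ _ h).trans ih
    rw [← (h₂ a).dist_eq_zero_iff.1 ha, ← (h₂ b).dist_eq_zero_iff.1 hb, hroot]

theorem exists_isLayering (G : SimpleGraph V) : ∃ l, G.IsLayering l :=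
  ⟨_, isLayering_dist (fun a => (G.connectedComponentMk a).out)
    (fun a b h => by rw [ConnectedComponent.sound h.reachable])
    (fun a => ConnectedComponent.exact (Quot.out_eq _))⟩

open Classical in
theorem exists_isLayering_of_root (G : SimpleGraph V) (v : V) :
    ∃ l, G.IsLayering l ∧ ∀ w (j : ℕ), G.edist v w = j → l w = j := by
  refine ⟨_, isLayering_dist
    (fun a => if G.Reachable v a then v else (G.connectedComponentMk a).out) ?_ ?_, ?_⟩
  · intro a b h
    have : G.Reachable v a ↔ G.Reachable v b :=
      ⟨fun h' => h'.trans h.reachable, fun h' => h'.trans h.symm.reachable⟩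
    simp only [this, ConnectedComponent.sound h.reachable]
  · intro a
    by_cases h : G.Reachable v a
    · rwa [if_pos h]
    · rw [if_neg h]
      exact ConnectedComponent.exact (Quot.out_eq _)
  · intro w j h
    have hr : G.Reachable v w := edist_ne_top_iff_reachable.1 (by rw [h]; exact ENat.natCast_ne_top j)
    simp only [if_pos hr, SimpleGraph.dist, h, ENat.toNat_natCast]

theorem IsOuterplanar.isDisjointUnionOfPaths_induce_bfsLayer [Finite V] (hG : G.IsOuterplanar)
    (v : V) (j : ℕ) : (G.induce (G.bfsLayer v j)).IsDisjointUnionOfPaths := by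
  obtain ⟨l, hl, hlv⟩ := G.exists_isLayering_of_root v
  let f : G.induce (G.bfsLayer v j) →g G.layerTorso l :=
    ⟨Subtype.val, fun {a b} h =>
      ⟨G.ne_of_adj h, (hlv a j a.2).trans (hlv b j b.2).symm, Or.inl h⟩⟩
  refine ((hl.isAcyclic_layerTorso hG).comap f Subtype.val_injective).isDisjointUnionOfPaths ?_
  exact fun u w hw hinj => hl.layerTorso_neighbors hG (fun i => f.map_adj (hw i))
    (Subtype.val_injective.comp hinj)

/-! ### Elimination forests from rankings -/

/-- The ancestors of `z` are the `x` whose component among the vertices of rank at least `rank x`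
contains `z`. Ancestors of one vertex have distinct ranks, which bounds the depth. -/
theorem hasEliminationForest_of_rank [Finite V] (rank : V → ℕ) (d : ℕ) (hd : ∀ x, rank x < d)
    (h : ∀ x y, rank x = rank y → G.JoinedOn {z | rank x ≤ rank z} x y → x = y) :
    G.HasEliminationForest d := by
  have hle : ∀ {x y}, G.JoinedOn {z | rank x ≤ rank z} x y → rank x ≤ rank y :=
    fun {x y} hxy => hxy.mem_iff.1 (le_refl (rank x))
  have hmono : ∀ {a b x y}, a ≤ b → G.JoinedOn {z | b ≤ rank z} x y →
      G.JoinedOn {z | a ≤ rank z} x y :=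
    fun hab hxy => hxy.mono fun _ hz => hab.trans hz
  refine ⟨fun x y => G.JoinedOn {z | rank x ≤ rank z} x y, fun x => Relation.ReflTransGen.refl,
    fun x y hxy hyx => h x y (le_antisymm (hle hxy) (hle hyx)) hxy,
    fun x y z hxy hyz => hxy.trans (hmono (hle hxy) hyz), fun x y z hxz hyz => ?_,
    fun x y hxy => ?_, fun z => ⟨Set.toFinite _, ?_⟩⟩
  · rcases le_total (rank x) (rank y) with hr | hr
    · exact Or.inl (hxz.trans (hmono hr hyz).symm)
    · exact Or.inr (hyz.trans (hmono hr hxz).symm)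
  · rcases le_total (rank x) (rank y) with hr | hr
    · exact Or.inl (.of_adj hxy (le_refl (rank x)) hr)
    · exact Or.inr (.of_adj hxy.symm (le_refl (rank y)) hr)
  · have := Set.ncard_le_ncard_of_injOn (s := {x | G.JoinedOn {z | rank x ≤ rank z} x z})
      (t := Set.Iio d) rank (fun x _ => hd x)
      (fun x hx y hy hxy => h x y hxy (JoinedOn.trans hx (hmono hxy.le hy).symm))
    simpa using this

theorem JoinedOn.of_induce {S : Set V} {A : Set S} {B : Set V} {x y : S}
    (hAB : ∀ z ∈ A, z.1 ∈ B) (h : (G.induce S).JoinedOn A x y) : G.JoinedOn B x y :=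
  Relation.ReflTransGen.lift Subtype.val
    (fun _ _ hab => ⟨hab.1, hAB _ hab.2.1, hAB _ hab.2.2⟩) _ _ h

/-! ### Removing every `m`-th layer and every `m`-th vertex of the torso paths -/

theorem div_eq_div_of_not_dvd_of_le_succ {m a b : ℕ} (hab : a ≤ b + 1) (hba : b ≤ a + 1)
    (ha : ¬ m ∣ a) (hb : ¬ m ∣ b) : a / m = b / m := by
  obtain rfl | rfl | rfl : a = b ∨ a = b + 1 ∨ b = a + 1 := by omega
  · rfl
  · rw [Nat.succ_div, if_neg ha, add_zero]
  · rw [Nat.succ_div, if_neg hb, add_zero]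

/-- Between two residues with the same power of two there is one with a higher power of two. -/
theorem exists_between_padicValNat_lt {m a b : ℕ} (hm : 0 < m) (hab : a < b) (hdiv : a / m = b / m)
    (ha : ¬ m ∣ a) (h : padicValNat 2 (a % m) = padicValNat 2 (b % m)) :
    ∃ c, a ≤ c ∧ c ≤ b ∧ padicValNat 2 (a % m) < padicValNat 2 (c % m) := by
  rw [Nat.dvd_iff_mod_eq_zero] at ha
  set k := padicValNat 2 (a % m) with hk
  have ea := Nat.div_add_mod a m
  have eb := Nat.div_add_mod b m
  rw [← hdiv] at eb
  have hrb := Nat.mod_lt b hm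
  obtain ⟨s, hs⟩ : 2 ^ k ∣ a % m := pow_padicValNat_dvd
  obtain ⟨t, ht⟩ : 2 ^ k ∣ b % m := h ▸ pow_padicValNat_dvd
  have hs2 : ¬ 2 ∣ s := by
    rintro ⟨s', rfl⟩
    exact pow_succ_padicValNat_not_dvd (p := 2) ha ⟨s', by rw [← hk, pow_succ]; linarith⟩
  have hst : s < t := by
    have : 2 ^ k * s < 2 ^ k * t := by omega
    exact lt_of_mul_lt_mul_left this (Nat.zero_le _)
  have hstep : 2 ^ k * (s + 1) ≤ 2 ^ k * t := Nat.mul_le_mul_left _ hst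
  rw [mul_add, mul_one] at hstep
  have hpos : 0 < 2 ^ k := by positivity
  -- Here `a % m = 2 ^ k * s` with `s` odd, so the next multiple of `2 ^ k` has the even cofactor `s
  -- + 1`; as `s < t`, it does not pass `b`.
  refine ⟨a + 2 ^ k, by omega, by omega, ?_⟩
  have hmod : (a + 2 ^ k) % m = 2 ^ k * (s + 1) := by
    have : a + 2 ^ k = 2 ^ k * (s + 1) + m * (a / m) := by rw [mul_add, mul_one]; omega
    rw [this, Nat.add_mul_mod_self_left, Nat.mod_eq_of_lt]
    rw [mul_add, mul_one]; omega
  rw [hmod, ← Nat.succ_le_iff, ← padicValNat_dvd_iff_le (by positivity), Nat.succ_eq_add_one,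
    pow_succ]
  exact Nat.mul_dvd_mul_left _ (by omega)

theorem padicValNat_two_mod_lt {m q a : ℕ} (hm : 0 < m) (hq : m ≤ 2 ^ q) (ha : ¬ m ∣ a) :
    padicValNat 2 (a % m) < q := by
  rw [Nat.dvd_iff_mod_eq_zero] at ha
  by_contra! h
  have h₁ := (padicValNat_dvd_iff_le (p := 2) ha).2 h
  have h₂ := Nat.le_of_dvd (Nat.pos_of_ne_zero ha) h₁
  have h₃ := Nat.mod_lt a hm
  omega

/-- The vertices in every `m`-th layer and the vertices at every `m`-th position. -/
def sparseSet (l pos : V → ℕ) (m s : ℕ) : Set V :=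
  {v | m ∣ l v + s ∨ m ∣ pos v + s}

/-- The rank in an elimination forest of the graph without a sparse set. -/
def sparseRank (l pos : V → ℕ) (m s q : ℕ) (v : V) : ℕ :=
  (l v + s) % m * q + (q - 1 - padicValNat 2 ((pos v + s) % m))

section

variable {l pos : V → ℕ}

/-- A walk below the layer of `x` is shadowed by a walk in the torso of that layer. -/
theorem exists_shadow {P : V → Prop} {A : Set V} {x y : V} (hA : ∀ z ∈ A, l x ≤ l z)
    (hx : P x) (hstep : ∀ w z, P w → (G.layerTorso l).Adj w z → z ∈ A → P z)
    (h : G.JoinedOn A x y) :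
    ∃ w, l w = l x ∧ P w ∧ (y = w ∨ y ∈ G.lowerSide l w) := by
  induction h with
  | refl => exact ⟨x, rfl, hx, Or.inl rfl⟩
  | @tail y z _ hyz ih =>
    obtain ⟨w, hw, hPw, hyw⟩ := ih
    obtain ⟨hadj, hyA, hzA⟩ := hyz
    rcases (hA z hzA).lt_or_eq with hlz | hlz
    · refine ⟨w, hw, hPw, Or.inr ?_⟩
      rcases hyw with rfl | hyw
      · exact ⟨z, hadj, hw ▸ hlz, Relation.ReflTransGen.refl⟩
      · exact mem_lowerSide_of_joinedOn hyw
          (.of_adj hadj (lt_of_mem_lowerSide hyw) (show l w < l z from hw ▸ hlz))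
    -- The walk is back in the layer at `z`. If it was below, the component just left is attached to
    -- both `w` and `z`, which makes them torso neighbours unless equal.
    · by_cases hwz : w = z
      · exact ⟨w, hw, hPw, Or.inl hwz.symm⟩
      · refine ⟨z, hlz.symm, hstep w z hPw ⟨hwz, hw.trans hlz, ?_⟩ hzA, Or.inl rfl⟩
        rcases hyw with rfl | hyw
        · exact Or.inl hadj
        · refine Or.inr ⟨y, hyw, y, hadj.symm, ?_, Relation.ReflTransGen.refl⟩
          have := lt_of_mem_lowerSide hyw
          omega

/-- The walk cannot cross a deleted layer, and the leading part of the rank keeps it from rising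
above the layer of `x`. Its shadow moves along a torso path one position at a time, crossing neither
a deleted position nor one divisible by a higher power of 2. Two positions of equal valuation in one
block always enclose such a position, so the ends coincide. -/
theorem eq_of_joinedOn_sparseRank {m s q : ℕ} (hm : 0 < m) (hq : m ≤ 2 ^ q)
    (hl : ∀ a b, G.Adj a b → l a ≤ l b + 1)
    (hpos : ∀ a b, (G.layerTorso l).Adj a b → pos a + 1 = pos b ∨ pos b + 1 = pos a)
    (hinj : ∀ a b, (G.layerTorso l).Reachable a b → pos a = pos b → a = b) {x y : V}
    (hx : x ∉ sparseSet l pos m s)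
    (hxy : sparseRank l pos m s q x = sparseRank l pos m s q y)
    (h : G.JoinedOn {z | z ∉ sparseSet l pos m s ∧
      sparseRank l pos m s q x ≤ sparseRank l pos m s q z} x y) : x = y := by
  set X := sparseSet l pos m s with hX
  -- This makes the truncated subtraction in `sparseRank` exact and its second summand a digit in
  -- base `q`.
  have hval : ∀ z ∉ X, padicValNat 2 ((pos z + s) % m) < q := fun z hz =>
    padicValNat_two_mod_lt hm hq fun h => hz (Or.inr h)
  have hq0 : 0 < q := (Nat.zero_le _).trans_lt (hval x hx)
  have hdivrank : ∀ z, sparseRank l pos m s q z / q = (l z + s) % m := fun z => by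
    rw [sparseRank, mul_comm, Nat.mul_add_div hq0, Nat.div_eq_of_lt (by omega), add_zero]
  have hlayer : ∀ z, G.JoinedOn Xᶜ x z → (l z + s) / m = (l x + s) / m := by
    intro z hz
    induction hz with
    | refl => rfl
    | @tail a b _ hab ih =>
      rw [← ih]
      have h₁ := hl _ _ hab.1
      have h₂ := hl _ _ hab.1.symm
      exact div_eq_div_of_not_dvd_of_le_succ (by omega) (by omega) (fun h => hab.2.2 (Or.inl h))
        (fun h => hab.2.1 (Or.inl h))
  let A : Set V := {z | z ∉ X ∧ sparseRank l pos m s q x ≤ sparseRank l pos m s q z ∧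
    (l z + s) / m = (l x + s) / m}
  have hA : G.JoinedOn A x y := by
    refine h.joinedOn_class.mono fun z hz => ?_
    have hz' := hz.mem_iff.1 ⟨hx, le_rfl⟩
    exact ⟨hz'.1, hz'.2, hlayer z (hz.mono fun _ h => h.1)⟩
  have hyA : y ∈ A := hA.mem_iff.1 ⟨hx, le_rfl, rfl⟩
  have hAl : ∀ z ∈ A, l x ≤ l z := by
    intro z hz
    have h₁ := Nat.div_le_div_right (c := q) hz.2.1
    rw [hdivrank, hdivrank] at h₁
    have h₂ := Nat.div_add_mod (l z + s) m
    have h₃ := Nat.div_add_mod (l x + s) m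
    rw [hz.2.2] at h₂
    omega
  have hAv : ∀ z ∈ A, l z = l x →
      padicValNat 2 ((pos z + s) % m) ≤ padicValNat 2 ((pos x + s) % m) := by
    intro z hz hlz
    have h₁ := hz.2.1
    rw [sparseRank, sparseRank, hlz] at h₁
    have := hval z hz.1
    have := hval x hx
    omega
  -- The invariant of the shadow bounds the valuation at all integers `c` between the two shifted
  -- positions, so it applies directly to the number found by `exists_between_padicValNat_lt`.
  let P : V → Prop := fun w => w ∉ X ∧ (G.layerTorso l).Reachable x w ∧
    (pos w + s) / m = (pos x + s) / m ∧
    ∀ c, (pos x + s ≤ c ∧ c ≤ pos w + s ∨ pos w + s ≤ c ∧ c ≤ pos x + s) →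
      padicValNat 2 (c % m) ≤ padicValNat 2 ((pos x + s) % m)
  have hstep : ∀ w z, P w → (G.layerTorso l).Adj w z → z ∈ A → P z := by
    rintro w z ⟨hwX, hr, hd, hb⟩ hwz hz
    have hp := hpos w z hwz
    have hr' := hr.trans hwz.reachable
    have hlz : l z = l x := by
      obtain ⟨p⟩ := hr'
      exact (reachable_of_layerTorso_walk p).2.symm
    refine ⟨hz.1, hr', ?_, fun c hc => ?_⟩
    · rw [← hd]
      exact div_eq_div_of_not_dvd_of_le_succ (by omega) (by omega) (fun h => hz.1 (Or.inr h))
        (fun h => hwX (Or.inr h))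
    · by_cases hcz : c = pos z + s
      · rw [hcz]
        exact hAv z hz hlz
      · exact hb c (by omega)
  obtain ⟨w, hw, hPw, hyw⟩ := exists_shadow hAl (P := P)
    ⟨hx, Reachable.rfl, rfl, fun c hc => by rw [show c = pos x + s by omega]⟩ hstep hA
  have hly : l y = l x := by
    have h₁ := congrArg (· / q) hxy
    simp only [hdivrank] at h₁
    have h₂ := Nat.div_add_mod (l y + s) m
    have h₃ := Nat.div_add_mod (l x + s) m
    rw [hyA.2.2] at h₂
    omega
  obtain rfl : y = w := by
    refine hyw.resolve_right fun h => ?_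
    have := lt_of_mem_lowerSide h
    omega
  obtain ⟨-, hr, hd, hb⟩ := hPw
  have hv : padicValNat 2 ((pos x + s) % m) = padicValNat 2 ((pos y + s) % m) := by
    have h₁ := hxy
    rw [sparseRank, sparseRank, hly] at h₁
    have := hval y hyA.1
    have := hval x hx
    omega
  refine hinj x y hr ?_
  by_contra hne
  rcases lt_or_gt_of_ne hne with hlt | hlt
  · obtain ⟨c, h₁, h₂, h₃⟩ := exists_between_padicValNat_lt (m := m) (a := pos x + s)
      (b := pos y + s) hm (by omega) hd.symm (fun h => hx (Or.inr h)) hv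
    exact absurd (hb c (Or.inl ⟨h₁, h₂⟩)) (not_le_of_gt h₃)
  · obtain ⟨c, h₁, h₂, h₃⟩ := exists_between_padicValNat_lt (m := m) (a := pos y + s)
      (b := pos x + s) hm (by omega) hd (fun h => hyA.1 (Or.inr h)) hv.symm
    exact absurd (hb c (Or.inr ⟨h₁, h₂⟩)) (not_le_of_gt (hv ▸ h₃))

theorem treedepth_induce_compl_sparseSet_le [Finite V] {m s q : ℕ} (hm : 0 < m) (hq : m ≤ 2 ^ q)
    (hq0 : 0 < q) (hl : ∀ a b, G.Adj a b → l a ≤ l b + 1)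
    (hpos : ∀ a b, (G.layerTorso l).Adj a b → pos a + 1 = pos b ∨ pos b + 1 = pos a)
    (hinj : ∀ a b, (G.layerTorso l).Reachable a b → pos a = pos b → a = b) :
    (G.induce (sparseSet l pos m s)ᶜ).treedepth ≤ m * q := by
  refine Nat.sInf_le (?_ : HasEliminationForest _ _)
  refine hasEliminationForest_of_rank
    (fun v : ((sparseSet l pos m s)ᶜ : Set V) => sparseRank l pos m s q v) _ ?_ ?_
  · intro x
    have h₁ : (l x.1 + s) % m + 1 ≤ m := Nat.mod_lt _ hm
    have h₂ := Nat.mul_le_mul_right q h₁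
    rw [add_mul, one_mul] at h₂
    simp only [sparseRank]
    omega
  · intro x y hxy h
    exact Subtype.ext (eq_of_joinedOn_sparseRank hm hq hl hpos hinj x.2 hxy
      (h.of_induce fun z hz => ⟨z.2, hz⟩))

/-- A vertex lies in at most two of the `m` sparse sets. -/
theorem card_sparseSet_le (l pos : V → ℕ) (m : ℕ) (v : V)
    [Fintype {s : Fin m | v ∈ sparseSet l pos m s}] :
    Fintype.card {s : Fin m | v ∈ sparseSet l pos m s} ≤ 2 := by
  classical
  have key : ∀ n, (Finset.univ.filter fun s : Fin m => m ∣ n + s).card ≤ 1 := by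
    intro n
    rw [Finset.card_le_one]
    intro a ha b hb
    simp only [Finset.mem_filter, Finset.mem_univ, true_and] at ha hb
    have hmod : n + a ≡ n + b [MOD m] := (Nat.modEq_zero_iff_dvd.2 ha).trans
      (Nat.modEq_zero_iff_dvd.2 hb).symm
    exact Fin.ext (Nat.ModEq.eq_of_lt_of_lt (Nat.ModEq.add_left_cancel' n hmod) a.2 b.2)
  have hsub : {s : Fin m | v ∈ sparseSet l pos m s}.toFinset ⊆
      (Finset.univ.filter fun s : Fin m => m ∣ l v + s) ∪
        (Finset.univ.filter fun s : Fin m => m ∣ pos v + s) := by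
    intro s hs
    rw [Set.mem_toFinset] at hs
    simpa [sparseSet] using hs
  rw [← Set.toFinset_card]
  refine (Finset.card_le_card hsub).trans ((Finset.card_union_le _ _).trans ?_)
  exact Nat.add_le_add (key _) (key _)

end

/-! ### The random sparse set and the rate -/

theorem ceil_logb_two_natCast (a : ℕ) : (⌈Real.logb 2 (a : ℝ)⌉ : ℝ) = (Nat.clog 2 a : ℝ) := by
  have h := Real.ceil_logb_natCast (b := 2) (r := (a : ℝ)) (Nat.cast_nonneg a)
  rw [Int.clog_natCast, Nat.cast_ofNat] at h
  rw [h, Int.cast_natCast]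

open Classical in
theorem IsOuterplanar.isFractionallyFragile_treedepth [Finite V] (hG : G.IsOuterplanar) :
    G.IsFractionallyFragile (fun _ G => (G.treedepth : ℝ))
      (fun a => 2 * (a : ℝ) * (1 + (⌈Real.logb 2 (a : ℝ)⌉ : ℝ))) := by
  simp only [ceil_logb_two_natCast]
  refine ⟨fun a b hab => ?_, fun a => by positivity, fun a ha => ?_⟩
  · have : (a : ℝ) ≤ b := Nat.cast_le.2 hab
    have : (Nat.clog 2 a : ℝ) ≤ Nat.clog 2 b := Nat.cast_le.2 (Nat.clog_mono_right 2 hab)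
    dsimp only
    gcongr
  obtain ⟨l, hl⟩ := G.exists_isLayering
  obtain ⟨pos, hpos, hinj⟩ := ((hl.isAcyclic_layerTorso hG).isDisjointUnionOfPaths
    fun u w hw => hl.layerTorso_neighbors hG hw).exists_position
  have : NeZero (2 * a) := ⟨by omega⟩
  refine ⟨(PMF.uniformOfFintype (Fin (2 * a))).map fun s : Fin (2 * a) => sparseSet l pos (2 * a) s, ?_, ?_⟩
  · intro X hX
    obtain ⟨s, -, rfl⟩ := (PMF.mem_support_map_iff _ _ _).1 hX
    -- The factor 2 in `m` pays for the two kinds of deletion, turning `2 / m` into `1 / a`; it also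
    -- costs the extra 1 in `q`, since `2 * a ≤ 2 ^ q` is needed.
    have h := treedepth_induce_compl_sparseSet_le (G := G) (s := s) (m := 2 * a)
      (q := 1 + Nat.clog 2 a) (by omega) (by
        rw [pow_add, pow_one]
        exact Nat.mul_le_mul_left 2 (Nat.le_pow_clog one_lt_two a)) (by omega)
      hl.le_of_adj hpos hinj
    dsimp only
    exact_mod_cast h
  · intro v
    rw [PMF.toOuterMeasure_map_apply, PMF.toOuterMeasure_uniformOfFintype_apply, Fintype.card_fin]
    have h : (Fintype.card ((fun s : Fin (2 * a) => sparseSet l pos (2 * a) s) ⁻¹' {X | v ∈ X}) :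
        ENNReal) ≤ 2 := by
      exact_mod_cast card_sparseSet_le l pos (2 * a) v
    refine (ENNReal.div_le_div_right h _).trans_eq ?_
    rw [Nat.cast_mul, Nat.cast_ofNat]
    nth_rw 1 [← mul_one (2 : ENNReal)]
    exact ENNReal.mul_div_mul_left _ _ two_ne_zero ENNReal.ofNat_ne_top

end SimpleGraph

theorem mainTheorem8 :
    SimpleGraph.IsFractionallyFragileClass.{u}
      (fun _ G => G.IsOuterplanar)
      (fun _ G => (G.treedepth : ℝ))
      (fun a => 2 * (a : ℝ) * (1 + (⌈Real.logb 2 (a : ℝ)⌉ : ℝ))) ∧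
    ∀ (V : Type u) [Finite V] (G : SimpleGraph V), G.IsOuterplanar → G.IsChordal →
      ∀ (v : V) (j : ℕ), (G.induce (G.bfsLayer v j)).IsDisjointUnionOfPaths :=
  ⟨fun _ _ _ hG => hG.isFractionallyFragile_treedepth,
    fun _ _ _ hG _ v j => hG.isDisjointUnionOfPaths_induce_bfsLayer v j⟩
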